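/- Let $\mathcal A$ be a Banach operator ideal (over $\mathbb R$ or $\mathbb C$), with norm $\|\cdot\|_{\mathcal A}$, and let $\overline{\mathcal F}$ be the ideal of approximable operators (operator-norm limits of finite rank operators) with the operator norm. A composition $\mathcal B\circ\mathcal C$ consists of the operators $T=UV$ with $U\in\mathcal B$, $V\in\mathcal C$, and $\|T\|_{\mathcal B\circ\mathcal C}=\inf\|U\|_{\mathcal B}\|V\|_{\mathcal C}$ over all such factorizations through Banach spaces. Suppose that $\mathcal A$ is right-accessible, that is, $\mathcal A^{min}:=\overline{\mathcal F}\circ\mathcal A\circ\overline{\mathcal F}$ equals $\mathcal A\circ\overline{\mathcal F}$ isometrically. A subset $K$ of a Banach space $F$ is relatively $\mathcal A$-compact if there are a Banach space $X$, an operator $S\in\mathcal A(X;F)$ and a compact set $M\subset X$ with $K\subset S(M)$; its size is $$m_{\mathcal A}(K;F)=\inf\{\|S\|_{\mathcal A}: K\subset S(M),\ S\in\mathcal A(X;F),\ M\subset B_X \text{ compact},\ X \text{ a Banach space}\},$$ where $B_X$ is the closed unit ball of $X$. Let $\mathcal K_{\mathcal A}(E;F)$ be the class of bounded operators $T\colon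 E\to F$ for which $T(B_E)$ is relatively $\mathcal A$-compact in $F$, with $\|T\|_{\mathcal K_{\mathcal A}}=m_{\mathcal A}(T(B_E);F)$. Then $\mathcal K_{\mathcal A}$ is regular, that is, $\mathcal K_{\mathcal A}=\mathcal K_{\mathcal A}^{reg}$ isometrically: for all Banach spaces $E$, $F$ and every bounded operator $T\colon E\to F$, with $J_F\colon F\to F''$ the canonical embedding into the bidual, $$T\in\mathcal K_{\mathcal A}(E;F)\iff J_F\circ T\in\mathcal K_{\mathcal A}(E;F''),$$ and in this case $\|T\|_{\mathcal K_{\mathcal A}}=\|J_F\circ T\|_{\mathcal K_{\mathcal A}}$. -/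

import Mathlib

universe u

/-- A class of bounded operators between Banach spaces over `𝕜`, together with a real number
attached to each operator (its size, only meaningful for members of the class). No laws are
required here; the laws of a Banach operator ideal are in `BanachOperatorIdeal`. The notation
`Mem T` is `T ∈ 𝒜(E; F)` and `idealNorm T` is `‖T‖_𝒜`. -/
structure OperatorClass (𝕜 : Type) [RCLike 𝕜] where
  Mem : ∀ {E F : Type u} [NormedAddCommGroup E] [NormedSpace 𝕜 E] [CompleteSpace E]
    [NormedAddCommGroup F] [NormedSpace 𝕜 F] [CompleteSpace F], (E →L[𝕜] F) → Prop
  idealNorm : ∀ {E F : Type u} [NormedAddCommGroup E] [NormedSpace 𝕜 E] [CompleteSpace E]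
    [NormedAddCommGroup F] [NormedSpace 𝕜 F] [CompleteSpace F], (E →L[𝕜] F) → ℝ

/-- A Banach operator ideal: every component is a linear space of bounded operators, complete for
the norm `idealNorm`, with the ideal property, containing the rank-one operators
`x ↦ x' x • y` with norm `‖x'‖ * ‖y‖`. -/
structure BanachOperatorIdeal (𝕜 : Type) [RCLike 𝕜] extends OperatorClass.{u} 𝕜 where
  add_mem : ∀ {E F : Type u} [NormedAddCommGroup E] [NormedSpace 𝕜 E] [CompleteSpace E]
    [NormedAddCommGroup F] [NormedSpace 𝕜 F] [CompleteSpace F] (S T : E →L[𝕜] F),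
    Mem S → Mem T → Mem (S + T)
  smul_mem : ∀ {E F : Type u} [NormedAddCommGroup E] [NormedSpace 𝕜 E] [CompleteSpace E]
    [NormedAddCommGroup F] [NormedSpace 𝕜 F] [CompleteSpace F] (c : 𝕜) (T : E →L[𝕜] F),
    Mem T → Mem (c • T)
  norm_add_le : ∀ {E F : Type u} [NormedAddCommGroup E] [NormedSpace 𝕜 E] [CompleteSpace E]
    [NormedAddCommGroup F] [NormedSpace 𝕜 F] [CompleteSpace F] (S T : E →L[𝕜] F),
    Mem S → Mem T → idealNorm (S + T) ≤ idealNorm S + idealNorm T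
  norm_smul : ∀ {E F : Type u} [NormedAddCommGroup E] [NormedSpace 𝕜 E] [CompleteSpace E]
    [NormedAddCommGroup F] [NormedSpace 𝕜 F] [CompleteSpace F] (c : 𝕜) (T : E →L[𝕜] F),
    Mem T → idealNorm (c • T) = ‖c‖ * idealNorm T
  eq_zero_of_norm : ∀ {E F : Type u} [NormedAddCommGroup E] [NormedSpace 𝕜 E] [CompleteSpace E]
    [NormedAddCommGroup F] [NormedSpace 𝕜 F] [CompleteSpace F] (T : E →L[𝕜] F),
    Mem T → idealNorm T = 0 → T = 0
  complete : ∀ {E F : Type u} [NormedAddCommGroup E] [NormedSpace 𝕜 E] [CompleteSpace E]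
    [NormedAddCommGroup F] [NormedSpace 𝕜 F] [CompleteSpace F] (T : ℕ → E →L[𝕜] F),
    (∀ n, Mem (T n)) →
    (∀ ε : ℝ, 0 < ε → ∃ N, ∀ m, N ≤ m → ∀ n, N ≤ n → idealNorm (T m - T n) < ε) →
    ∃ S : E →L[𝕜] F, Mem S ∧
      Filter.Tendsto (fun n => idealNorm (T n - S)) Filter.atTop (nhds 0)
  comp_mem : ∀ {D E F G : Type u} [NormedAddCommGroup D] [NormedSpace 𝕜 D] [CompleteSpace D]
    [NormedAddCommGroup E] [NormedSpace 𝕜 E] [CompleteSpace E]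
    [NormedAddCommGroup F] [NormedSpace 𝕜 F] [CompleteSpace F]
    [NormedAddCommGroup G] [NormedSpace 𝕜 G] [CompleteSpace G]
    (S : F →L[𝕜] G) (T : E →L[𝕜] F) (R : D →L[𝕜] E), Mem T → Mem (S ∘L T ∘L R)
  norm_comp_le : ∀ {D E F G : Type u} [NormedAddCommGroup D] [NormedSpace 𝕜 D] [CompleteSpace D]
    [NormedAddCommGroup E] [NormedSpace 𝕜 E] [CompleteSpace E]
    [NormedAddCommGroup F] [NormedSpace 𝕜 F] [CompleteSpace F]
    [NormedAddCommGroup G] [NormedSpace 𝕜 G] [CompleteSpace G]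
    (S : F →L[𝕜] G) (T : E →L[𝕜] F) (R : D →L[𝕜] E), Mem T →
    idealNorm (S ∘L T ∘L R) ≤ ‖S‖ * idealNorm T * ‖R‖
  rankOne_mem : ∀ {E F : Type u} [NormedAddCommGroup E] [NormedSpace 𝕜 E] [CompleteSpace E]
    [NormedAddCommGroup F] [NormedSpace 𝕜 F] [CompleteSpace F] (f : E →L[𝕜] 𝕜) (y : F),
    Mem (f.smulRight y)
  norm_rankOne : ∀ {E F : Type u} [NormedAddCommGroup E] [NormedSpace 𝕜 E] [CompleteSpace E]
    [NormedAddCommGroup F] [NormedSpace 𝕜 F] [CompleteSpace F] (f : E →L[𝕜] 𝕜) (y : F),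
    idealNorm (f.smulRight y) = ‖f‖ * ‖y‖

namespace OperatorClass

variable {𝕜 : Type} [RCLike 𝕜]

/-- Isometric equality `𝒜 = ℬ`: the same members, with the same norms. -/
def IsometricEq (𝒜 ℬ : OperatorClass.{u} 𝕜) : Prop :=
  ∀ (E F : Type u) [NormedAddCommGroup E] [NormedSpace 𝕜 E] [CompleteSpace E]
    [NormedAddCommGroup F] [NormedSpace 𝕜 F] [CompleteSpace F] (T : E →L[𝕜] F),
    (𝒜.Mem T ↔ ℬ.Mem T) ∧ (𝒜.Mem T → 𝒜.idealNorm T = ℬ.idealNorm T)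

variable (𝕜) in
/-- The approximable operators: limits in operator norm of finite rank operators, with the
operator norm. -/
noncomputable def approximable : OperatorClass.{u} 𝕜 where
  Mem {E F} _ _ _ _ _ _ T :=
    T ∈ closure {S : E →L[𝕜] F | FiniteDimensional 𝕜 (LinearMap.range (S : E →ₗ[𝕜] F))}
  idealNorm T := ‖T‖

/-- The composition `𝒜 ∘ ℬ`: the operators `U ∘ V` with `U ∈ 𝒜(G; F)`, `V ∈ ℬ(E; G)` for some
Banach space `G`, with the infimum of `‖U‖_𝒜 * ‖V‖_ℬ` over all such factorizations. -/
noncomputable def comp (𝒜 ℬ : OperatorClass.{u} 𝕜) : OperatorClass.{u} 𝕜 where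
  Mem {E F} _ _ _ _ _ _ T :=
    ∃ (G : Type u) (_ : NormedAddCommGroup G) (_ : NormedSpace 𝕜 G) (_ : CompleteSpace G)
      (U : G →L[𝕜] F) (V : E →L[𝕜] G), 𝒜.Mem U ∧ ℬ.Mem V ∧ T = U ∘L V
  idealNorm {E F} _ _ _ _ _ _ T :=
    sInf {r : ℝ | ∃ (G : Type u) (_ : NormedAddCommGroup G) (_ : NormedSpace 𝕜 G)
      (_ : CompleteSpace G) (U : G →L[𝕜] F) (V : E →L[𝕜] G),
      𝒜.Mem U ∧ ℬ.Mem V ∧ T = U ∘L V ∧ r = 𝒜.idealNorm U * ℬ.idealNorm V}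

/-- The minimal kernel of `𝒜`: approximable `∘ 𝒜 ∘` approximable. -/
noncomputable def minKernel (𝒜 : OperatorClass.{u} 𝕜) : OperatorClass.{u} 𝕜 :=
  (approximable 𝕜).comp (𝒜.comp (approximable 𝕜))

/-- The regular hull: the operators `T : E → F` with `J_F ∘ T ∈ 𝒜(E; F'')`, where `J_F` is the
canonical embedding of `F` in its bidual, with the norm `‖J_F ∘ T‖_𝒜`. -/
noncomputable def regularHull (𝒜 : OperatorClass.{u} 𝕜) : OperatorClass.{u} 𝕜 where
  Mem {E F} _ _ _ _ _ _ T :=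
    𝒜.Mem (E := E) (F := StrongDual 𝕜 (StrongDual 𝕜 F))
      (NormedSpace.inclusionInDoubleDual 𝕜 F ∘L T)
  idealNorm {E F} _ _ _ _ _ _ T :=
    𝒜.idealNorm (E := E) (F := StrongDual 𝕜 (StrongDual 𝕜 F))
      (NormedSpace.inclusionInDoubleDual 𝕜 F ∘L T)

/-- `𝒜` is regular if it equals its regular hull isometrically. -/
def IsRegular (𝒜 : OperatorClass.{u} 𝕜) : Prop :=
  𝒜.IsometricEq 𝒜.regularHull

end OperatorClass

namespace BanachOperatorIdeal

variable {𝕜 : Type} [RCLike 𝕜]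

/-- `𝒜` is right-accessible: its minimal kernel is `𝒜 ∘` approximable, isometrically. -/
def IsRightAccessible (𝒜 : BanachOperatorIdeal.{u} 𝕜) : Prop :=
  𝒜.toOperatorClass.minKernel.IsometricEq
    (𝒜.toOperatorClass.comp (OperatorClass.approximable 𝕜))

/-- `K ⊆ E` is relatively `𝒜`-compact: `K ⊆ S(M)` for some Banach space `X`, some `S ∈ 𝒜(X; E)`
and some compact `M ⊆ X`. -/
def RelativelyCompact (𝒜 : BanachOperatorIdeal.{u} 𝕜) {E : Type u} [NormedAddCommGroup E]
    [NormedSpace 𝕜 E] [CompleteSpace E] (K : Set E) : Prop :=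
  ∃ (X : Type u) (_ : NormedAddCommGroup X) (_ : NormedSpace 𝕜 X) (_ : CompleteSpace X)
    (S : X →L[𝕜] E) (M : Set X), 𝒜.Mem S ∧ IsCompact M ∧ K ⊆ S '' M

/-- The size `m_𝒜(K; E)` of a relatively `𝒜`-compact set `K ⊆ E`: the infimum of `‖S‖_𝒜` over all
Banach spaces `X`, `S ∈ 𝒜(X; E)` and compact `M` in the closed unit ball of `X` with
`K ⊆ S(M)`. -/
noncomputable def compactSize (𝒜 : BanachOperatorIdeal.{u} 𝕜) {E : Type u}
    [NormedAddCommGroup E] [NormedSpace 𝕜 E] [CompleteSpace E] (K : Set E) : ℝ :=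
  sInf {r : ℝ | ∃ (X : Type u) (_ : NormedAddCommGroup X) (_ : NormedSpace 𝕜 X)
    (_ : CompleteSpace X) (S : X →L[𝕜] E) (M : Set X),
    𝒜.Mem S ∧ IsCompact M ∧ M ⊆ Metric.closedBall 0 1 ∧ K ⊆ S '' M ∧ r = 𝒜.idealNorm S}

/-- The `𝒜`-compact operators `𝒦_𝒜`: the operators `T : E → F` for which `T(B_E)` is relatively
`𝒜`-compact in `F`, with `‖T‖_{𝒦_𝒜} = m_𝒜(T(B_E); F)`, where `B_E` is the closed unit ball. -/
noncomputable def compactOperators (𝒜 : BanachOperatorIdeal.{u} 𝕜) : OperatorClass.{u} 𝕜 where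
  Mem {E _} _ _ _ _ _ _ T := 𝒜.RelativelyCompact (T '' Metric.closedBall (0 : E) 1)
  idealNorm {E _} _ _ _ _ _ _ T := 𝒜.compactSize (T '' Metric.closedBall (0 : E) 1)

end BanachOperatorIdeal

/-! Composing with `J_F` never increases sizes, so the point is to pull a cover `J_F(K) ⊆ S(M)` in
`F''` back to `F` with no loss of norm. Lift `M` to `ℓ¹(K)`: the operator `q` with `q e_x = m x ∈
M`, `S (m x) = J_F x`, is approximable, so right-accessibility factors `S q = U V W` with `U`, `W`
approximable and `V ∈ 𝒜`. Thus `J_F u = U V W`, where `u e_x = x` takes values in `F`. As `U` is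
nearly of finite rank, local reflexivity (`exists_approx_localReflexivity`) pushes its range into
`F`, and for finite rank `Q` this gives `‖u Q‖_𝒜 ≤ ‖U‖ ‖V W Q‖_𝒜` (`idealNorm_comp_finiteRank_le`).
Compactness of `W` on the unit vectors yields finite rank `Q n` with telescoping sums and `‖W Q n‖`
decaying like `4⁻ⁿ`. Then `∑ 2ⁿ u (Q n)`, acting on the coordinates of bounded sequences in `ℓ¹(K)`,
converges in `𝒜` and maps a compact set of sequences with coordinates of size `2⁻ⁿ` onto a set
containing `K` (`exists_compact_cover_of_factorization`). -/

/-! ### Local reflexivity. -/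

section LocalReflexivity

set_option maxSynthPendingDepth 3

variable {𝕜 : Type*} [RCLike 𝕜]

/-- A functional on a finite `ℓ^∞`-sum has norm at least the sum of the norms of its components. -/
theorem sum_norm_single_le_norm {κ : Type*} [Fintype κ] [DecidableEq κ] {F : Type*}
    [NormedAddCommGroup F] [NormedSpace 𝕜 F] (g : StrongDual 𝕜 (κ → F)) :
    ∑ j, ‖g ∘L ContinuousLinearMap.single 𝕜 (fun _ : κ => F) j‖ ≤ ‖g‖ := by
  set ψ : κ → StrongDual 𝕜 F := fun j => g ∘L ContinuousLinearMap.single 𝕜 (fun _ : κ => F) j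
  have hg : ∀ w : κ → F, g w = ∑ j, ψ j (w j) := fun w => by
    conv_lhs => rw [← Finset.univ_sum_single w, map_sum]
    rfl
  -- Almost norming vectors of the components, rotated to make the values real, glue to one vector
  -- of sup norm at most one.
  have key : ∀ t : κ → ℝ, (∀ j, t j < ‖ψ j‖) → ∑ j, t j ≤ ‖g‖ := by
    intro t ht
    have : ∀ j, ∃ w : F, ‖w‖ ≤ 1 ∧ t j ≤ RCLike.re (ψ j w) := by
      intro j
      rcases lt_or_ge (t j) 0 with h0 | h0
      · exact ⟨0, by simp, by simpa using h0.le⟩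
      · lift t j to NNReal using h0 with r hr
        obtain ⟨x, hx1, hx2⟩ := (ψ j).exists_lt_apply_of_lt_opNorm (ht j)
        obtain ⟨c, hc, hcx⟩ := RCLike.exists_norm_eq_mul_self (ψ j x)
        refine ⟨c • x, by simpa [norm_smul, hc] using hx1.le, ?_⟩
        rw [map_smul, smul_eq_mul, ← hcx, RCLike.ofReal_re]
        exact hr ▸ hx2.le
    choose w hw1 hw2 using this
    calc ∑ j, t j ≤ ∑ j, RCLike.re (ψ j (w j)) := Finset.sum_le_sum fun j _ => hw2 j
      _ = RCLike.re (g w) := by rw [hg, map_sum]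
      _ ≤ ‖g w‖ := RCLike.re_le_norm _
      _ ≤ ‖g‖ * ‖w‖ := g.le_opNorm w
      _ ≤ ‖g‖ := mul_le_of_le_one_right (norm_nonneg _)
          ((pi_norm_le_iff_of_nonneg zero_le_one).2 hw1)
  refine le_of_forall_pos_le_add fun ε hε => ?_
  have h := key (fun j => ‖ψ j‖ - ε / (Fintype.card κ + 1)) fun j => by
    have : 0 < ε / (Fintype.card κ + 1 : ℝ) := by positivity
    linarith
  rw [Finset.sum_sub_distrib, Finset.sum_const, Finset.card_univ, nsmul_eq_mul] at h
  have : (Fintype.card κ : ℝ) * (ε / (Fintype.card κ + 1)) ≤ ε := by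
    rw [mul_div_assoc', div_le_iff₀ (by positivity)]
    nlinarith
  linarith

/-- The operator norm on a finite-dimensional space is, up to `1 + ε`, attained on a finite set. -/
theorem exists_finset_norming {N F : Type*} [NormedAddCommGroup N] [NormedSpace 𝕜 N]
    [FiniteDimensional 𝕜 N] [NormedAddCommGroup F] [NormedSpace 𝕜 F] {ε : ℝ} (hε : 0 < ε) :
    ∃ s : Finset N, (∀ x ∈ s, ‖x‖ ≤ 1) ∧ ∀ (R : N →L[𝕜] F) (m : ℝ), 0 ≤ m →
      (∀ x ∈ s, ‖R x‖ ≤ m) → ‖R‖ ≤ (1 + ε) * m := by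
  have : ProperSpace N := FiniteDimensional.proper_rclike 𝕜 N
  -- An `η`-net of the ball gives `‖R‖ ≤ m + η ‖R‖`, and `1 / (1 - η) = 1 + ε`.
  set η : ℝ := ε / (1 + ε) with hη
  have hη0 : 0 < η := by positivity
  obtain ⟨t, ht, htf, hcov⟩ := (isCompact_closedBall (0 : N) 1).finite_cover_balls hη0
  refine ⟨htf.toFinset, fun x hx => by simpa using ht (htf.mem_toFinset.1 hx), ?_⟩
  intro R m hm hR
  have h1 : ‖R‖ ≤ m + η * ‖R‖ := by
    refine ContinuousLinearMap.opNorm_le_of_unit_norm (𝕜 := 𝕜) (by positivity) fun x hx => ?_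
    have hx' : x ∈ Metric.closedBall (0 : N) 1 := by simp [hx]
    obtain ⟨y, hy, hxy⟩ := Set.mem_iUnion₂.1 (hcov hx')
    rw [Metric.mem_ball, dist_eq_norm] at hxy
    calc ‖R x‖ = ‖R y + R (x - y)‖ := by rw [← map_add]; congr 2; abel
      _ ≤ ‖R y‖ + ‖R (x - y)‖ := norm_add_le _ _
      _ ≤ m + ‖R‖ * η := add_le_add (hR y (htf.mem_toFinset.2 hy))
          ((R.le_opNorm _).trans (by gcongr))
      _ = m + η * ‖R‖ := by ring
  have h2 : (1 + ε) * η = ε := by rw [hη]; field_simp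
  have h3 : (1 + ε) * ‖R‖ ≤ (1 + ε) * m + ε * ‖R‖ := by
    calc (1 + ε) * ‖R‖ ≤ (1 + ε) * (m + η * ‖R‖) := by gcongr
      _ = (1 + ε) * m + ((1 + ε) * η) * ‖R‖ := by ring
      _ = _ := by rw [h2]
  linarith

/-- Hahn–Banach extension along an injective bounded operator. -/
theorem exists_strongDual_extension {P Q : Type*} [NormedAddCommGroup P] [NormedSpace 𝕜 P]
    [NormedAddCommGroup Q] [NormedSpace 𝕜 Q] (A : P →L[𝕜] Q) (hA : Function.Injective A)
    (Φ : StrongDual 𝕜 P) {u : ℝ} (hu : 0 ≤ u) (h : ∀ R, ‖Φ R‖ ≤ u * ‖A R‖) :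
    ∃ g : StrongDual 𝕜 Q, (∀ R, g (A R) = Φ R) ∧ ‖g‖ ≤ u := by
  let e := LinearEquiv.ofInjective (A : P →ₗ[𝕜] Q) hA
  have he : ∀ p, A (e.symm p) = p := fun p => congrArg Subtype.val (e.apply_symm_apply p)
  obtain ⟨g, hg, hgn⟩ := exists_extension_norm_eq _
    (LinearMap.mkContinuous ((Φ : P →ₗ[𝕜] 𝕜) ∘ₗ e.symm.toLinearMap) u fun p => by
      have h1 := h (e.symm p)
      rwa [he p] at h1)
  refine ⟨g, fun R => ?_, hgn.trans_le (LinearMap.mkContinuous_norm_le _ hu _)⟩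
  have h1 := hg (e R)
  change g (A R) = Φ (e.symm (e R)) at h1
  rwa [e.symm_apply_apply] at h1

/-- A functional `∑ i, φ i (R (y i))` of norm less than `u` on the operators `R : N → F` extends
to the operators from `N` to the bidual of `F`, with the same bound. -/
theorem norm_sum_bidual_apply_le {F N : Type*} [NormedAddCommGroup F] [NormedSpace 𝕜 F]
    [NormedAddCommGroup N] [NormedSpace 𝕜 N] [FiniteDimensional 𝕜 N]
    (j : N →L[𝕜] StrongDual 𝕜 (StrongDual 𝕜 F)) (hj : ‖j‖ ≤ 1)
    {ι : Type*} [Fintype ι] (φ : ι → StrongDual 𝕜 F) (y : ι → N) {ε u : ℝ} (hε : 0 < ε)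
    (hu : 0 ≤ u) (h : ∀ R : N →L[𝕜] F, (1 + ε) * ‖∑ i, φ i (R (y i))‖ ≤ u * ‖R‖) :
    ‖∑ i, j (y i) (φ i)‖ ≤ u := by
  classical
  let Φ : StrongDual 𝕜 (N →L[𝕜] F) := ∑ i, φ i ∘L ContinuousLinearMap.apply 𝕜 F (y i)
  have hΦdef : ∀ R, Φ R = ∑ i, φ i (R (y i)) := fun R => by simp [Φ]
  have hΦ : ∀ R : N →L[𝕜] F, (1 + ε) * ‖Φ R‖ ≤ u * ‖R‖ := fun R => by
    rw [hΦdef]; exact h R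
  clear_value Φ
  obtain ⟨s, hs1, hs⟩ := exists_finset_norming (𝕜 := 𝕜) (N := N) (F := F) hε
  -- Evaluation on `s` embeds the operators in a finite `ℓ^∞`-sum, whose functionals are families
  -- `ψ`; the distortion `1 + ε` is absorbed by `h`.
  let A : (N →L[𝕜] F) →L[𝕜] (s → F) :=
    ContinuousLinearMap.pi fun x => ContinuousLinearMap.apply 𝕜 F (x : N)
  have hA : ∀ R, ‖R‖ ≤ (1 + ε) * ‖A R‖ := fun R =>
    hs R _ (norm_nonneg _) fun x hx => norm_le_pi_norm (A R) ⟨x, hx⟩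
  have hAinj : Function.Injective A := by
    refine (injective_iff_map_eq_zero A).2 fun R hR => ?_
    have := hA R
    rw [hR, norm_zero, mul_zero] at this
    exact norm_le_zero_iff.1 this
  obtain ⟨g, hgA, hgu⟩ := exists_strongDual_extension A hAinj Φ hu fun R => by
    have h1 : u * ‖R‖ ≤ u * ((1 + ε) * ‖A R‖) := by gcongr; exact hA R
    have h2 : (1 + ε) * ‖Φ R‖ ≤ (1 + ε) * (u * ‖A R‖) := by linarith [hΦ R]
    exact le_of_mul_le_mul_left h2 (by positivity)
  set ψ : s → StrongDual 𝕜 F := fun x => g ∘L ContinuousLinearMap.single 𝕜 (fun _ : s => F) x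
  have hgs : ∀ w : s → F, g w = ∑ x, ψ x (w x) := fun w => by
    conv_lhs => rw [← Finset.univ_sum_single w, map_sum]
    rfl
  -- Testing on rank-one operators is enough: `N` has finite dimension, so expanding `j` in a basis
  -- carries the identity over to the bidual.
  have hξ : ∀ ξ : N →L[𝕜] 𝕜, ∑ i, ξ (y i) • φ i = ∑ x : s, ξ x • ψ x := by
    intro ξ
    ext z
    have h := hgA (ξ.smulRight z)
    rw [hgs, hΦdef] at h
    simpa [A] using h.symm
  let b := Module.finBasis 𝕜 N
  have hrep : ∀ z : N, j z = ∑ l, (b.coord l).toContinuousLinearMap z • j (b l) := fun z => by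
    conv_lhs => rw [← b.sum_repr z, map_sum]
    simp
  have heq : ∑ i, j (y i) (φ i) = ∑ x : s, j x (ψ x) := by
    have h1 : ∀ i, j (y i) (φ i) =
        ∑ l, j (b l) ((b.coord l).toContinuousLinearMap (y i) • φ i) := fun i => by
      conv_lhs => rw [hrep (y i)]
      simp
    have h2 : ∀ x : s, j x (ψ x) =
        ∑ l, j (b l) ((b.coord l).toContinuousLinearMap (x : N) • ψ x) := fun x => by
      conv_lhs => rw [hrep x]
      simp
    simp only [h1, h2]
    rw [Finset.sum_comm, Finset.sum_comm (s := (Finset.univ : Finset s))]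
    refine Finset.sum_congr rfl fun l _ => ?_
    rw [← map_sum, hξ, map_sum]
  rw [heq]
  calc ‖∑ x : s, j x (ψ x)‖ ≤ ∑ x : s, ‖ψ x‖ := by
        refine norm_sum_le_of_le _ fun x _ => ?_
        refine ((j x).le_opNorm _).trans (mul_le_of_le_one_left (norm_nonneg _) ?_)
        exact (j.le_opNorm _).trans (mul_le_one₀ hj (norm_nonneg _) (hs1 x x.2))
    _ ≤ ‖g‖ := sum_norm_single_le_norm g
    _ ≤ u := hgu

/-- A form of the principle of local reflexivity. -/
theorem exists_approx_localReflexivity {F N : Type*} [NormedAddCommGroup F] [NormedSpace 𝕜 F]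
    [NormedAddCommGroup N] [NormedSpace 𝕜 N] [FiniteDimensional 𝕜 N]
    (j : N →L[𝕜] StrongDual 𝕜 (StrongDual 𝕜 F)) (hj : ‖j‖ ≤ 1)
    {ι : Type*} [Fintype ι] (v : ι → F) (y : ι → N)
    (hy : ∀ i, j (y i) = NormedSpace.inclusionInDoubleDual 𝕜 F (v i))
    {ε δ : ℝ} (hε : 0 < ε) (hδ : 0 < δ) :
    ∃ R : N →L[𝕜] F, ‖R‖ ≤ 1 + ε ∧ ∀ i, ‖R (y i) - v i‖ ≤ δ := by
  classical
  let ev : (N →L[𝕜] F) →L[𝕜] (ι → F) :=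
    ContinuousLinearMap.pi fun i => ContinuousLinearMap.apply 𝕜 F (y i)
  have hev : ∀ R i, ev R i = R (y i) := fun R i => rfl
  set C : Set (ι → F) := ev '' Metric.closedBall 0 (1 + ε)
  -- Otherwise Hahn–Banach separates `v` from `C` by some `f`; since `f v` is the bidual pairing of
  -- the `j (y i)`, the bound of `f` on `C` would extend to `v`.
  suffices hmem : v ∈ closure C by
    obtain ⟨w, ⟨R, hR, rfl⟩, hw⟩ := Metric.mem_closure_iff.1 hmem δ hδ
    refine ⟨R, by simpa using hR, fun i => ?_⟩
    rw [← hev, ← dist_eq_norm, dist_comm]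
    exact (dist_le_pi_dist v (ev R) i).trans hw.le
  by_contra hv
  let _ : NormedSpace ℝ F := NormedSpace.restrictScalars ℝ 𝕜 F
  have : IsScalarTower ℝ 𝕜 F := RestrictScalars.isScalarTower ℝ 𝕜 F
  have hconv : Convex ℝ (closure C) :=
    Convex.closure ((convex_closedBall (0 : N →L[𝕜] F) (1 + ε)).linear_image
      (ev.restrictScalars ℝ).toLinearMap)
  obtain ⟨f, u, hfC, hfv⟩ :=
    RCLike.geometric_hahn_banach_closed_point (𝕜 := 𝕜) hconv isClosed_closure hv
  have hf : ∀ w : ι → F, f w =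
      ∑ i, (f ∘L ContinuousLinearMap.single 𝕜 (fun _ : ι => F) i) (w i) := fun w => by
    conv_lhs => rw [← Finset.univ_sum_single w, map_sum]
    rfl
  -- The ball is balanced, so a bound on real parts bounds absolute values.
  have hΦball : ∀ R : N →L[𝕜] F, ‖R‖ ≤ 1 + ε → ‖f (ev R)‖ ≤ u := by
    intro R hR
    obtain ⟨c, hc, hcx⟩ := RCLike.exists_norm_eq_mul_self (f (ev R))
    have := hfC (ev (c • R)) (subset_closure ⟨c • R, by simpa [norm_smul, hc] using hR, rfl⟩)
    rw [map_smul, map_smul, smul_eq_mul, ← hcx, RCLike.ofReal_re] at this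
    exact this.le
  have hu : 0 ≤ u := (norm_nonneg _).trans (hΦball 0 (by simp; positivity))
  refine absurd (hfv.trans_le (RCLike.re_le_norm _)) (not_lt.2 ?_)
  have hfv' : f v = ∑ i, j (y i)
      (f ∘L ContinuousLinearMap.single 𝕜 (fun _ : ι => F) i) := by
    rw [hf]
    exact Finset.sum_congr rfl fun i _ => by rw [hy]; rfl
  rw [hfv']
  refine norm_sum_bidual_apply_le j hj _ y hε hu fun R => ?_
  rw [show ∑ i, (f ∘L ContinuousLinearMap.single 𝕜 (fun _ : ι => F) i) (R (y i)) = f (ev R) from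
    (hf _).symm]
  rcases eq_or_ne R 0 with rfl | hR
  · simp
  have hR' : 0 < ‖R‖ := norm_pos_iff.2 hR
  have h := hΦball ((((1 + ε) / ‖R‖ : ℝ) : 𝕜) • R) (by
    rw [norm_smul, RCLike.norm_ofReal, abs_of_nonneg (by positivity), div_mul_cancel₀ _ hR'.ne'])
  rw [map_smul, map_smul, norm_smul, RCLike.norm_ofReal, abs_of_nonneg (by positivity),
    div_mul_eq_mul_div, div_le_iff₀ hR'] at h
  exact h

end LocalReflexivity

/-! ### Operators on `ℓ¹(Γ)` and finite discretizations of `Γ`. -/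

section SummableFamilies

set_option maxSynthPendingDepth 3

variable {𝕜 : Type*} [RCLike 𝕜] {Γ : Type*} {X : Type*} [NormedAddCommGroup X] [NormedSpace 𝕜 X]

open Classical in
/-- The unit vectors of `ℓ¹(Γ)`. -/
noncomputable def lpOneBasis (𝕜 : Type*) [RCLike 𝕜] {Γ : Type*} (γ : Γ) : lp (fun _ : Γ => 𝕜) 1 :=
  lp.single 1 γ (1 : 𝕜)

theorem norm_lpOneBasis (γ : Γ) : ‖lpOneBasis 𝕜 γ‖ = 1 := by
  classical
  rw [lpOneBasis, lp.norm_single zero_lt_one, norm_one]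

theorem lpOne_ext {L L' : lp (fun _ : Γ => 𝕜) 1 →L[𝕜] X}
    (h : ∀ γ, L (lpOneBasis 𝕜 γ) = L' (lpOneBasis 𝕜 γ)) : L = L' := by
  classical
  refine lp.ext_continuousLinearMap (by simp) fun γ => ?_
  ext
  exact h γ

/-- Bounded families indexed by `Γ` extend to bounded operators on `ℓ¹(Γ)`. -/
theorem exists_lpOne_lift [CompleteSpace X] (f : Γ → X) {C : ℝ} (hC : 0 ≤ C)
    (hf : ∀ γ, ‖f γ‖ ≤ C) :
    ∃ L : lp (fun _ : Γ => 𝕜) 1 →L[𝕜] X, (∀ γ, L (lpOneBasis 𝕜 γ) = f γ) ∧ ‖L‖ ≤ C := by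
  classical
  have hs : ∀ a : lp (fun _ : Γ => 𝕜) 1, Summable fun γ => ‖a γ‖ := fun a => by
    simpa using a.2.summable
  have hb : ∀ (a : lp (fun _ : Γ => 𝕜) 1) γ, ‖a γ • f γ‖ ≤ ‖a γ‖ * C := fun a γ => by
    rw [norm_smul]; gcongr; exact hf γ
  have hsum : ∀ a : lp (fun _ : Γ => 𝕜) 1, Summable fun γ => a γ • f γ := fun a =>
    Summable.of_norm_bounded ((hs a).mul_right C) (hb a)
  refine ⟨LinearMap.mkContinuous
    { toFun := fun a => ∑' γ, a γ • f γ
      map_add' := fun a b => by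
        rw [← (hsum a).tsum_add (hsum b)]
        exact tsum_congr fun γ => add_smul _ _ _
      map_smul' := fun c a => by
        rw [RingHom.id_apply, ← (hsum a).tsum_const_smul c]
        exact tsum_congr fun γ => smul_assoc c _ _ } C fun a => ?_, fun γ => ?_,
    LinearMap.mkContinuous_norm_le _ hC _⟩
  · have hn : ‖a‖ = ∑' γ, ‖a γ‖ := by
      rw [lp.norm_eq_tsum_rpow (by simp)]; simp
    change ‖∑' γ, a γ • f γ‖ ≤ C * ‖a‖
    rw [hn, mul_comm, ← tsum_mul_right]
    exact tsum_of_norm_bounded ((hs a).mul_right C).hasSum (hb a)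
  · change ∑' γ', (lpOneBasis 𝕜 γ) γ' • f γ' = f γ
    rw [tsum_eq_single γ fun γ' h => by rw [lpOneBasis, lp.single_apply_ne _ _ _ h, zero_smul],
      lpOneBasis, lp.single_apply_self, one_smul]

theorem lpOne_opNorm_le [CompleteSpace X] (L : lp (fun _ : Γ => 𝕜) 1 →L[𝕜] X) {C : ℝ}
    (hC : 0 ≤ C) (hL : ∀ γ, ‖L (lpOneBasis 𝕜 γ)‖ ≤ C) : ‖L‖ ≤ C := by
  obtain ⟨L', h1, h2⟩ := exists_lpOne_lift (𝕜 := 𝕜) _ hC hL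
  rwa [lpOne_ext h1] at h2

/-- An operator on `ℓ¹(Γ)` with finitely many values on the unit vectors has finite rank. -/
theorem lpOne_eq_sum_rankOne [CompleteSpace X] (L : lp (fun _ : Γ => 𝕜) 1 →L[𝕜] X)
    (hL : (Set.range fun γ => L (lpOneBasis 𝕜 γ)).Finite) :
    ∃ (s : Finset X) (p : X → StrongDual 𝕜 (lp (fun _ : Γ => 𝕜) 1)),
      L = ∑ d ∈ s, (p d).smulRight d := by
  classical
  have : ∀ d : X, ∃ p : StrongDual 𝕜 (lp (fun _ : Γ => 𝕜) 1),
      (∀ γ, p (lpOneBasis 𝕜 γ) = if L (lpOneBasis 𝕜 γ) = d then 1 else 0) ∧ ‖p‖ ≤ 1 := fun d =>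
    exists_lpOne_lift _ zero_le_one fun γ => by split_ifs <;> simp
  choose p hp _ using this
  refine ⟨hL.toFinset, p, lpOne_ext fun γ => ?_⟩
  simp [hp]

theorem exists_finite_section {β : Type*} (f : Γ → β) (hf : (Set.range f).Finite) :
    ∃ σ : Γ → Γ, (Set.range σ).Finite ∧ ∀ γ, f (σ γ) = f γ := by
  have := hf.to_subtype
  choose g hg using fun b : Set.range f => b.2
  refine ⟨fun γ => g ⟨f γ, γ, rfl⟩, (Set.finite_range g).subset ?_, fun γ => hg _⟩
  rintro _ ⟨γ, rfl⟩
  exact ⟨_, rfl⟩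

/-- The net is replaced by representatives in `Γ` itself, so that `π` can later act on unit vectors
of `ℓ¹(Γ)`. -/
theorem exists_finite_discretization {Y : Type*} [SeminormedAddCommGroup Y] (h : Γ → Y)
    (hh : TotallyBounded (Set.range h)) {δ : ℝ} (hδ : 0 < δ) :
    ∃ π : Γ → Γ, (Set.range π).Finite ∧ ∀ γ, ‖h (π γ) - h γ‖ ≤ δ := by
  obtain ⟨t, htf, ht⟩ := Metric.totallyBounded_iff.1 hh (δ / 2) (half_pos hδ)
  have : ∀ γ, ∃ c ∈ t, h γ ∈ Metric.ball c (δ / 2) := fun γ => by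
    simpa using ht ⟨γ, rfl⟩
  choose c hct hc using this
  obtain ⟨σ, hσ, hcσ⟩ := exists_finite_section c
    (htf.subset (by rintro _ ⟨γ, rfl⟩; exact hct γ))
  refine ⟨σ, hσ, fun γ => ?_⟩
  rw [← dist_eq_norm]
  have h1 := hc (σ γ)
  have h2 := hc γ
  rw [hcσ, Metric.mem_ball] at h1
  rw [Metric.mem_ball] at h2
  have := dist_triangle_right (h (σ γ)) (h γ) (c γ)
  linarith

end SummableFamilies

/-! ### Approximable operators and total boundedness. -/

section Approximable

variable {𝕜 : Type*} [RCLike 𝕜] {Γ : Type*} {X Y : Type*} [NormedAddCommGroup X] [NormedSpace 𝕜 X]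
  [NormedAddCommGroup Y] [NormedSpace 𝕜 Y]

theorem finiteDimensional_range_sum_rankOne {s : Finset Y} (p : Y → StrongDual 𝕜 X) :
    FiniteDimensional 𝕜
      (LinearMap.range ((∑ d ∈ s, (p d).smulRight d : X →L[𝕜] Y) : X →ₗ[𝕜] Y)) := by
  have := FiniteDimensional.span_finset 𝕜 s
  refine Submodule.finiteDimensional_of_le (S₂ := Submodule.span 𝕜 (s : Set Y)) ?_
  rintro _ ⟨x, rfl⟩
  rw [ContinuousLinearMap.coe_coe, sum_apply]
  exact Submodule.sum_mem _ fun d hd => Submodule.smul_mem _ _ (Submodule.subset_span hd)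

/-- An operator on `ℓ¹(Γ)` with totally bounded values on the unit vectors is approximable. -/
theorem lpOne_approximable [CompleteSpace X] (L : lp (fun _ : Γ => 𝕜) 1 →L[𝕜] X)
    (hL : TotallyBounded (Set.range fun γ => L (lpOneBasis 𝕜 γ))) :
    L ∈ closure {S : lp (fun _ : Γ => 𝕜) 1 →L[𝕜] X |
      FiniteDimensional 𝕜 (LinearMap.range (S : lp (fun _ : Γ => 𝕜) 1 →ₗ[𝕜] X))} := by
  refine Metric.mem_closure_iff.2 fun ε hε => ?_
  obtain ⟨π, hπ, hπL⟩ := exists_finite_discretization _ hL (half_pos hε)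
  -- Finitely many values on unit vectors force finite rank, and the norm of `L' - L` is controlled
  -- on unit vectors.
  obtain ⟨L', hL', _⟩ := exists_lpOne_lift (𝕜 := 𝕜) (fun γ => L (lpOneBasis 𝕜 (π γ)))
    (norm_nonneg L) fun γ => (L.le_opNorm _).trans (by rw [norm_lpOneBasis, mul_one])
  obtain ⟨s, p, hs⟩ := lpOne_eq_sum_rankOne L' (by
    simp only [hL']
    exact (hπ.image fun γ => L (lpOneBasis 𝕜 γ)).subset
      (by rintro _ ⟨γ, rfl⟩; exact ⟨_, ⟨γ, rfl⟩, rfl⟩))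
  refine ⟨L', ?_, ?_⟩
  · rw [hs]
    exact finiteDimensional_range_sum_rankOne p
  · rw [dist_comm, dist_eq_norm]
    refine (lpOne_opNorm_le _ (half_pos hε).le fun γ => ?_).trans_lt (half_lt_self hε)
    rw [sub_apply, hL']
    exact hπL γ

theorem totallyBounded_image_of_approximable [CompleteSpace Y] {L : X →L[𝕜] Y}
    (hL : L ∈ closure {S : X →L[𝕜] Y |
      FiniteDimensional 𝕜 (LinearMap.range (S : X →ₗ[𝕜] Y))}) (r : ℝ) :
    TotallyBounded (L '' Metric.closedBall 0 r) := by
  have hsub : {S : X →L[𝕜] Y | FiniteDimensional 𝕜 (LinearMap.range (S : X →ₗ[𝕜] Y))} ⊆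
      {S : X →L[𝕜] Y | IsCompactOperator S} := fun S hS => by
    have : FiniteDimensional 𝕜 (LinearMap.range (S : X →ₗ[𝕜] Y)) := hS
    have : ProperSpace (LinearMap.range (S : X →ₗ[𝕜] Y)) := FiniteDimensional.proper_rclike 𝕜 _
    exact (isCompactOperator_of_locallyCompactSpace_dom
      (S.codRestrict (LinearMap.range (S : X →ₗ[𝕜] Y)) fun x => ⟨x, rfl⟩)).clm_comp
        (LinearMap.range (S : X →ₗ[𝕜] Y)).subtypeL
  have hc : IsCompactOperator L :=
    closure_minimal hsub isClosed_setOfPred_isCompactOperator hL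
  exact (hc.isCompact_closure_image_closedBall r).totallyBounded.subset subset_closure

end Approximable

/-! ### Norm estimates in a Banach operator ideal. -/

namespace BanachOperatorIdeal

set_option maxSynthPendingDepth 3

variable {𝕜 : Type} [RCLike 𝕜] (𝒜 : BanachOperatorIdeal.{u} 𝕜)
  {E F G Z : Type u} [NormedAddCommGroup E] [NormedSpace 𝕜 E] [CompleteSpace E]
  [NormedAddCommGroup F] [NormedSpace 𝕜 F] [CompleteSpace F]
  [NormedAddCommGroup G] [NormedSpace 𝕜 G] [CompleteSpace G]
  [NormedAddCommGroup Z] [NormedSpace 𝕜 Z] [CompleteSpace Z]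

theorem zero_mem : 𝒜.Mem (0 : E →L[𝕜] F) := by
  simpa using 𝒜.rankOne_mem (0 : E →L[𝕜] 𝕜) (0 : F)

theorem idealNorm_zero : 𝒜.idealNorm (0 : E →L[𝕜] F) = 0 := by
  simpa using 𝒜.norm_rankOne (0 : E →L[𝕜] 𝕜) (0 : F)

variable {𝒜}

theorem neg_mem {T : E →L[𝕜] F} (hT : 𝒜.Mem T) : 𝒜.Mem (-T) := by
  simpa using 𝒜.smul_mem (-1) T hT

theorem idealNorm_neg {T : E →L[𝕜] F} (hT : 𝒜.Mem T) : 𝒜.idealNorm (-T) = 𝒜.idealNorm T := by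
  simpa using 𝒜.norm_smul (-1) T hT

theorem sub_mem {S T : E →L[𝕜] F} (hS : 𝒜.Mem S) (hT : 𝒜.Mem T) : 𝒜.Mem (S - T) := by
  rw [sub_eq_add_neg]
  exact 𝒜.add_mem _ _ hS (neg_mem hT)

theorem idealNorm_sub_comm {S T : E →L[𝕜] F} (hS : 𝒜.Mem S) (hT : 𝒜.Mem T) :
    𝒜.idealNorm (S - T) = 𝒜.idealNorm (T - S) := by
  rw [← neg_sub, idealNorm_neg (sub_mem hT hS)]

theorem idealNorm_nonneg {T : E →L[𝕜] F} (hT : 𝒜.Mem T) : 0 ≤ 𝒜.idealNorm T := by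
  have h := 𝒜.norm_add_le _ _ hT (neg_mem hT)
  rw [add_neg_cancel, idealNorm_zero, idealNorm_neg hT] at h
  linarith

theorem left_comp_mem {T : E →L[𝕜] F} (hT : 𝒜.Mem T) (S : F →L[𝕜] G) : 𝒜.Mem (S ∘L T) :=
  𝒜.comp_mem S T (ContinuousLinearMap.id 𝕜 E) hT

theorem right_comp_mem {T : E →L[𝕜] F} (hT : 𝒜.Mem T) (R : G →L[𝕜] E) : 𝒜.Mem (T ∘L R) :=
  𝒜.comp_mem (ContinuousLinearMap.id 𝕜 F) T R hT

theorem idealNorm_left_comp_le {T : E →L[𝕜] F} (hT : 𝒜.Mem T) (S : F →L[𝕜] G) :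
    𝒜.idealNorm (S ∘L T) ≤ ‖S‖ * 𝒜.idealNorm T :=
  (𝒜.norm_comp_le S T (ContinuousLinearMap.id 𝕜 E) hT).trans
    (mul_le_of_le_one_right (mul_nonneg (norm_nonneg _) (idealNorm_nonneg hT))
      ContinuousLinearMap.norm_id_le)

theorem idealNorm_right_comp_le {T : E →L[𝕜] F} (hT : 𝒜.Mem T) (R : G →L[𝕜] E) :
    𝒜.idealNorm (T ∘L R) ≤ 𝒜.idealNorm T * ‖R‖ := by
  refine (𝒜.norm_comp_le (ContinuousLinearMap.id 𝕜 F) T R hT).trans ?_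
  gcongr
  exact mul_le_of_le_one_left (idealNorm_nonneg hT) ContinuousLinearMap.norm_id_le

/-- Composing with `f ⊗ x`, where `f` norms `x`, gives the rank-one operator `f ⊗ T x`, whose ideal
norm is known. -/
theorem norm_le_idealNorm {T : E →L[𝕜] F} (hT : 𝒜.Mem T) : ‖T‖ ≤ 𝒜.idealNorm T := by
  refine T.opNorm_le_bound (idealNorm_nonneg hT) fun x => ?_
  rcases eq_or_ne x 0 with rfl | hx
  · simp
  obtain ⟨f, hf, -⟩ := exists_dual_vector 𝕜 x (norm_ne_zero_iff.2 hx)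
  have h := idealNorm_right_comp_le hT (f.smulRight x)
  have he : T ∘L f.smulRight x = f.smulRight (T x) := by ext; simp
  rwa [he, 𝒜.norm_rankOne, ContinuousLinearMap.norm_smulRight_apply, hf, one_mul, one_mul] at h

theorem sum_mem {ι : Type*} (s : Finset ι) {T : ι → E →L[𝕜] F} (hT : ∀ i ∈ s, 𝒜.Mem (T i)) :
    𝒜.Mem (∑ i ∈ s, T i) :=
  Finset.sum_induction T 𝒜.Mem 𝒜.add_mem 𝒜.zero_mem hT

theorem idealNorm_sum_le {ι : Type*} (s : Finset ι) {T : ι → E →L[𝕜] F}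
    (hT : ∀ i ∈ s, 𝒜.Mem (T i)) :
    𝒜.idealNorm (∑ i ∈ s, T i) ≤ ∑ i ∈ s, 𝒜.idealNorm (T i) :=
  Finset.le_sum_of_subadditive_on_pred 𝒜.idealNorm 𝒜.Mem 𝒜.idealNorm_zero.le
    𝒜.norm_add_le 𝒜.add_mem T hT

/-- Absolutely convergent series in a component of a Banach operator ideal. -/
theorem exists_sum_of_summable {T : ℕ → E →L[𝕜] F} (hT : ∀ n, 𝒜.Mem (T n)) {c : ℕ → ℝ}
    (hc : ∀ n, 𝒜.idealNorm (T n) ≤ c n) (hs : Summable c) :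
    ∃ S : E →L[𝕜] F, 𝒜.Mem S ∧ 𝒜.idealNorm S ≤ ∑' n, c n ∧
      ∀ x, Filter.Tendsto (fun n => ∑ i ∈ Finset.range n, T i x) Filter.atTop (nhds (S x)) := by
  have hc0 : ∀ n, 0 ≤ c n := fun n => (idealNorm_nonneg (hT n)).trans (hc n)
  set P : ℕ → E →L[𝕜] F := fun n => ∑ i ∈ Finset.range n, T i with hP
  have hPm : ∀ n, 𝒜.Mem (P n) := fun n => sum_mem _ fun i _ => hT i
  have hdist : ∀ m n, n ≤ m →
      𝒜.idealNorm (P m - P n) ≤ |∑ i ∈ Finset.range m, c i - ∑ i ∈ Finset.range n, c i| := by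
    intro m n hnm
    rw [hP, ← Finset.sum_Ico_eq_sub _ hnm, ← Finset.sum_Ico_eq_sub _ hnm]
    exact (idealNorm_sum_le _ fun i _ => hT i).trans
      ((Finset.sum_le_sum fun i _ => hc i).trans (le_abs_self _))
  obtain ⟨S, hS, hlim⟩ := 𝒜.complete P hPm (by
    intro ε hε
    obtain ⟨N, hN⟩ := Metric.cauchySeq_iff.1 hs.hasSum.tendsto_sum_nat.cauchySeq ε hε
    refine ⟨N, fun m hm n hn => ?_⟩
    rcases le_total n m with h | h
    · exact (hdist m n h).trans_lt (hN m hm n hn)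
    · rw [idealNorm_sub_comm (hPm m) (hPm n)]
      exact (hdist n m h).trans_lt (hN n hn m hm))
  refine ⟨S, hS, ?_, fun x => ?_⟩
  · have h : ∀ n, 𝒜.idealNorm S ≤ ∑' n, c n + 𝒜.idealNorm (P n - S) := fun n => by
      have h1 := 𝒜.norm_add_le _ _ (hPm n) (sub_mem hS (hPm n))
      rw [add_sub_cancel, idealNorm_sub_comm hS (hPm n)] at h1
      have h2 : 𝒜.idealNorm (P n) ≤ ∑' n, c n :=
        (idealNorm_sum_le _ fun i _ => hT i).trans ((Finset.sum_le_sum fun i _ => hc i).trans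
          (hs.sum_le_tsum _ fun i _ => hc0 i))
      linarith
    simpa using ge_of_tendsto' (hlim.const_add (∑' n, c n)) h
  · rw [tendsto_iff_norm_sub_tendsto_zero]
    refine squeeze_zero (fun _ => norm_nonneg _) (fun n => ?_)
      (by simpa using hlim.mul_const ‖x‖)
    have h : ∑ i ∈ Finset.range n, T i x - S x = (P n - S) x := by simp [hP]
    rw [h]
    exact (P n - S).le_of_opNorm_le (norm_le_idealNorm (sub_mem (hPm n) hS)) x

/-- If `J_F ∘ u` factors as an approximable operator after `V`, then the factorization bounds the
ideal norm of `u ∘ Q` for all finite rank operators `Q`. -/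
theorem idealNorm_comp_finiteRank_le {u : E →L[𝕜] F} {V : E →L[𝕜] Z} (hV : 𝒜.Mem V)
    {U : Z →L[𝕜] StrongDual 𝕜 (StrongDual 𝕜 F)}
    (hU : U ∈ closure {S : Z →L[𝕜] StrongDual 𝕜 (StrongDual 𝕜 F) |
      FiniteDimensional 𝕜 (LinearMap.range (S : Z →ₗ[𝕜] StrongDual 𝕜 (StrongDual 𝕜 F)))})
    (hfac : ∀ x, NormedSpace.inclusionInDoubleDual 𝕜 F (u x) = U (V x))
    (s : Finset E) (p : E → StrongDual 𝕜 G) (Q : G →L[𝕜] E)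
    (hQ : Q = ∑ d ∈ s, (p d).smulRight d) :
    𝒜.Mem (u ∘L Q) ∧ 𝒜.idealNorm (u ∘L Q) ≤ ‖U‖ * 𝒜.idealNorm (V ∘L Q) := by
  have hcompQ : ∀ w : E →L[𝕜] F, w ∘L Q = ∑ d ∈ s, (p d).smulRight (w d) := fun w => by
    ext x
    simp [hQ]
  have hmem : ∀ w : E →L[𝕜] F, 𝒜.Mem (w ∘L Q) := fun w => by
    rw [hcompQ]
    exact sum_mem _ fun d _ => 𝒜.rankOne_mem _ _
  refine ⟨hmem u, ?_⟩
  have hVQ := right_comp_mem hV Q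
  have key : ∀ η : ℝ, 0 < η → 𝒜.idealNorm (u ∘L Q) ≤
      (1 + η) * (‖U‖ + η) * 𝒜.idealNorm (V ∘L Q) +
        ∑ d ∈ s, ‖p d‖ * (η + (1 + η) * (η * ‖V d‖)) := by
    intro η hη
    obtain ⟨U₀, hU₀, hUU₀⟩ := Metric.mem_closure_iff.1 hU η hη
    rw [dist_eq_norm] at hUU₀
    have hfd : FiniteDimensional 𝕜
      (LinearMap.range (U₀ : Z →ₗ[𝕜] StrongDual 𝕜 (StrongDual 𝕜 F))) := hU₀
    let J := NormedSpace.inclusionInDoubleDual 𝕜 F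
    let N₁ : Submodule 𝕜 (StrongDual 𝕜 (StrongDual 𝕜 F)) :=
      Submodule.span 𝕜 (Set.range fun d : s => J (u d))
    have hfd₁ : FiniteDimensional 𝕜 N₁ := FiniteDimensional.span_of_finite 𝕜 (Set.finite_range _)
    -- `N` contains the range of `U₀`, so that `R` can follow it, and the vectors `J (u d)`, which
    -- `R` nearly returns to `u d`.
    let N := LinearMap.range (U₀ : Z →ₗ[𝕜] StrongDual 𝕜 (StrongDual 𝕜 F)) ⊔ N₁
    have hfdN : FiniteDimensional 𝕜 N := Submodule.finiteDimensional_sup _ _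
    let y : s → N := fun d => ⟨J (u d), Submodule.mem_sup_right (Submodule.subset_span ⟨d, rfl⟩)⟩
    obtain ⟨R, hR, hRy⟩ := exists_approx_localReflexivity N.subtypeL N.norm_subtypeL_le
      (fun d : s => u d) y (fun _ => rfl) hη hη
    let U₁ : Z →L[𝕜] N := U₀.codRestrict N fun z => Submodule.mem_sup_left ⟨z, rfl⟩
    have hU₁ : ‖U₁‖ ≤ ‖U‖ + η := by
      have h1 : ‖U₁‖ ≤ ‖U₀‖ := U₁.opNorm_le_bound (norm_nonneg _) fun z => U₀.le_opNorm z
      have h2 : ‖U₀‖ ≤ ‖U‖ + ‖U₀ - U‖ := by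
        simpa using _root_.norm_add_le U (U₀ - U)
      rw [norm_sub_rev] at h2
      linarith
    -- The remainder is a sum of rank-one operators, one for each `d ∈ s`, so it only needs
    -- smallness at these finitely many vectors.
    have hsplit : u ∘L Q = (R ∘L U₁) ∘L (V ∘L Q) + (u - (R ∘L U₁) ∘L V) ∘L Q := by
      ext x; simp
    have hd : ∀ d ∈ s, ‖(u - (R ∘L U₁) ∘L V) d‖ ≤ η + (1 + η) * (η * ‖V d‖) := by
      intro d hds
      have h1 : (u - (R ∘L U₁) ∘L V) d =
          -(R (y ⟨d, hds⟩) - u d) + R (y ⟨d, hds⟩ - U₁ (V d)) := by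
        simp
      have h2 : ‖y ⟨d, hds⟩ - U₁ (V d)‖ ≤ η * ‖V d‖ := by
        change ‖J (u d) - U₀ (V d)‖ ≤ _
        rw [hfac]
        exact (U - U₀).le_of_opNorm_le hUU₀.le (V d)
      rw [h1]
      refine (_root_.norm_add_le _ _).trans (add_le_add ?_ ?_)
      · rw [norm_neg]
        exact hRy ⟨d, hds⟩
      · exact (R.le_of_opNorm_le hR _).trans (by gcongr)
    rw [hsplit]
    refine (𝒜.norm_add_le _ _ (left_comp_mem hVQ _) (hmem _)).trans (add_le_add ?_ ?_)
    · refine (idealNorm_left_comp_le hVQ _).trans ?_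
      have := idealNorm_nonneg hVQ
      gcongr
      exact (R.opNorm_comp_le U₁).trans (by gcongr)
    · rw [hcompQ]
      refine (idealNorm_sum_le _ fun d _ => 𝒜.rankOne_mem _ _).trans 
        (Finset.sum_le_sum fun d hds => ?_)
      rw [𝒜.norm_rankOne]
      gcongr
      exact hd d hds
  -- `s` and `p` do not depend on `η`, so all error terms vanish as `η → 0`.
  have hcont : Continuous fun η : ℝ => (1 + η) * (‖U‖ + η) * 𝒜.idealNorm (V ∘L Q) +
        ∑ d ∈ s, ‖p d‖ * (η + (1 + η) * (η * ‖V d‖)) := by fun_prop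
  have hlim := (hcont.tendsto 0).mono_left (nhdsWithin_le_nhds (s := Set.Ioi 0))
  refine ge_of_tendsto (b := 𝒜.idealNorm (u ∘L Q)) (by simpa using hlim) ?_
  filter_upwards [self_mem_nhdsWithin] with η hη using key η hη

end BanachOperatorIdeal

/-! ### Total boundedness in spaces of bounded sequences. -/

section BoundedSequences

open scoped BoundedContinuousFunction

/-- Tails are uniformly small, and the first `N` coordinates take only finitely many joint values.
-/
theorem totallyBounded_range_boundedSeq {Γ D : Type*} [NormedAddCommGroup D] (z : ℕ → Γ → D)
    (hz : ∀ n, (Set.range (z n)).Finite) (hzn : ∀ n x, ‖z n x‖ ≤ (1 / 2) ^ n)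
    (ξ : Γ → ℕ →ᵇ D) (hξ : ∀ x n, ξ x n = z n x) : TotallyBounded (Set.range ξ) := by
  refine Metric.totallyBounded_iff.2 fun ε hε => ?_
  obtain ⟨N, hN⟩ := exists_pow_lt_of_lt_one (show (0 : ℝ) < ε / 4 by positivity)
    (show (1 / 2 : ℝ) < 1 by norm_num)
  obtain ⟨σ, hσ, hσz⟩ := exists_finite_section (fun x (i : Fin N) => z i x)
    ((Set.Finite.pi' fun i : Fin N => hz i).subset (by
      rintro _ ⟨x, rfl⟩ i
      exact ⟨x, rfl⟩))
  refine ⟨ξ '' Set.range σ, hσ.image ξ, ?_⟩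
  rintro _ ⟨x, rfl⟩
  refine Set.mem_iUnion₂.2 ⟨ξ (σ x), ⟨σ x, ⟨x, rfl⟩, rfl⟩, ?_⟩
  rw [Metric.mem_ball]
  refine lt_of_le_of_lt ((BoundedContinuousFunction.dist_le (half_pos hε).le).2 fun n => ?_)
    (half_lt_self hε)
  rw [hξ, hξ]
  rcases lt_or_ge n N with h | h
  · rw [show z n (σ x) = z n x from congrFun (hσz x) ⟨n, h⟩, dist_self]
    exact (half_pos hε).le
  · have h1 : (1 / 2 : ℝ) ^ n ≤ (1 / 2) ^ N := pow_le_pow_of_le_one (by norm_num) (by norm_num) h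
    have h2 := dist_le_norm_add_norm (z n x) (z n (σ x))
    linarith [hzn n x, hzn n (σ x)]

end BoundedSequences

/-! ### Descent of compact covers from `F''` to `F`. -/

theorem OperatorClass.exists_of_comp_idealNorm_lt {𝕜 : Type} [RCLike 𝕜]
    {𝒜 ℬ : OperatorClass.{u} 𝕜} {E F : Type u}
    [NormedAddCommGroup E] [NormedSpace 𝕜 E] [CompleteSpace E]
    [NormedAddCommGroup F] [NormedSpace 𝕜 F] [CompleteSpace F] {T : E →L[𝕜] F}
    (hT : (𝒜.comp ℬ).Mem T) {b : ℝ} (h : (𝒜.comp ℬ).idealNorm T < b) :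
    ∃ (G : Type u) (_ : NormedAddCommGroup G) (_ : NormedSpace 𝕜 G) (_ : CompleteSpace G)
      (U : G →L[𝕜] F) (V : E →L[𝕜] G), 𝒜.Mem U ∧ ℬ.Mem V ∧ T = U ∘L V ∧
        𝒜.idealNorm U * ℬ.idealNorm V < b := by
  obtain ⟨G, iG, jG, kG, U, V, hU, hV, hfac⟩ := hT
  simp only [OperatorClass.comp] at h
  obtain ⟨_, ⟨G, _, _, _, U, V, hU, hV, hfac, rfl⟩, hr⟩ :=
    exists_lt_of_csInf_lt (by exact ⟨_, G, iG, jG, kG, U, V, hU, hV, hfac, rfl⟩) h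
  exact ⟨G, _, _, ‹_›, U, V, hU, hV, hfac, hr⟩

namespace BanachOperatorIdeal

set_option maxSynthPendingDepth 3

open scoped BoundedContinuousFunction

variable {𝕜 : Type} [RCLike 𝕜] {𝒜 : BanachOperatorIdeal.{u} 𝕜}

/-- The operators between Banach spaces that are limits of finite rank operators. -/
def IsApproximable {E F : Type u} [NormedAddCommGroup E] [NormedSpace 𝕜 E]
    [NormedAddCommGroup F] [NormedSpace 𝕜 F] (T : E →L[𝕜] F) : Prop :=
  T ∈ closure {S : E →L[𝕜] F | FiniteDimensional 𝕜 (LinearMap.range (S : E →ₗ[𝕜] F))}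

/-- The only direct use of right-accessibility: it supplies an approximable factor on the left, as
local reflexivity requires. -/
theorem exists_minKernel_factorization (h𝒜 : 𝒜.IsRightAccessible)
    {E F X : Type u} [NormedAddCommGroup E] [NormedSpace 𝕜 E] [CompleteSpace E]
    [NormedAddCommGroup F] [NormedSpace 𝕜 F] [CompleteSpace F]
    [NormedAddCommGroup X] [NormedSpace 𝕜 X] [CompleteSpace X]
    {S : X →L[𝕜] F} (hS : 𝒜.Mem S) {q : E →L[𝕜] X} (hq : IsApproximable q) (hq1 : ‖q‖ ≤ 1)
    {b : ℝ} (hb : 𝒜.idealNorm S < b) :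
    ∃ (Z : Type u) (_ : NormedAddCommGroup Z) (_ : NormedSpace 𝕜 Z) (_ : CompleteSpace Z)
      (Y : Type u) (_ : NormedAddCommGroup Y) (_ : NormedSpace 𝕜 Y) (_ : CompleteSpace Y)
      (U : Z →L[𝕜] F) (V : Y →L[𝕜] Z) (W : E →L[𝕜] Y),
      IsApproximable U ∧ 𝒜.Mem V ∧ IsApproximable W ∧ S ∘L q = U ∘L (V ∘L W) ∧
        ‖U‖ * (𝒜.idealNorm V * ‖W‖) < b := by
  obtain ⟨h1, h2⟩ := h𝒜 E F (S ∘L q)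
  have hmem : (𝒜.toOperatorClass.comp (OperatorClass.approximable 𝕜)).Mem (S ∘L q) :=
    ⟨X, _, _, ‹_›, S, q, hS, hq, rfl⟩
  have hmin := h1.2 hmem
  have hle : (𝒜.toOperatorClass.comp (OperatorClass.approximable 𝕜)).idealNorm (S ∘L q) ≤
      𝒜.idealNorm S := by
    simp only [OperatorClass.comp]
    refine (csInf_le (a := 𝒜.idealNorm S * ‖q‖) ⟨0, ?_⟩
      (by exact ⟨X, _, _, ‹_›, S, q, hS, hq, rfl, rfl⟩)).trans
      (mul_le_of_le_one_right (idealNorm_nonneg hS) hq1)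
    rintro r ⟨G, _, _, _, A, B, hA, hB, -, rfl⟩
    exact mul_nonneg (idealNorm_nonneg hA) (norm_nonneg B)
  rw [← h2 hmin] at hle
  obtain ⟨Z, _, _, _, U, V', hU, hV', hfac, hr⟩ :=
    OperatorClass.exists_of_comp_idealNorm_lt hmin (hle.trans_lt hb)
  change ‖U‖ * (𝒜.toOperatorClass.comp (OperatorClass.approximable 𝕜)).idealNorm V' < b at hr
  set t := (𝒜.toOperatorClass.comp (OperatorClass.approximable 𝕜)).idealNorm V' with ht
  -- Slack for the inner infimum that stays below `b - ‖U‖ * t` after multiplication by `‖U‖`, even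
  -- when `U = 0`.
  have hη : 0 < (b - ‖U‖ * t) / (‖U‖ + 1) := by
    have := norm_nonneg U
    exact div_pos (by linarith) (by linarith)
  have htη : t < t + (b - ‖U‖ * t) / (‖U‖ + 1) := by linarith
  obtain ⟨Y, _, _, _, V, W, hV, hW, hVW, hr'⟩ :=
    OperatorClass.exists_of_comp_idealNorm_lt hV' htη
  change 𝒜.idealNorm V * ‖W‖ < _ at hr'
  refine ⟨Z, _, _, ‹_›, Y, _, _, ‹_›, U, V, W, hU, hV, hW, by rw [hfac, hVW], ?_⟩
  have hU0 := norm_nonneg U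
  calc ‖U‖ * (𝒜.idealNorm V * ‖W‖) ≤ ‖U‖ * (t + (b - ‖U‖ * t) / (‖U‖ + 1)) := by gcongr
    _ < b := by
      have h : (b - ‖U‖ * t) / (‖U‖ + 1) * (‖U‖ + 1) = b - ‖U‖ * t :=
        div_mul_cancel₀ _ (by positivity)
      nlinarith

variable {F : Type u} [NormedAddCommGroup F] [NormedSpace 𝕜 F] [CompleteSpace F]

/-- A set `K ⊆ F` whose unit vectors in `ℓ¹(K)` factor through `U ∘ V ∘ W` into the bidual, with `U`
and `W` approximable and `V ∈ 𝒜`, is contained in the image of a compact set under an operator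
of `𝒜` with values in `F`. -/
theorem exists_compact_cover_of_factorization {K : Set F} {C : ℝ} (hK : ∀ x ∈ K, ‖x‖ ≤ C)
    {Z Y : Type u} [NormedAddCommGroup Z] [NormedSpace 𝕜 Z] [CompleteSpace Z]
    [NormedAddCommGroup Y] [NormedSpace 𝕜 Y] [CompleteSpace Y]
    {U : Z →L[𝕜] StrongDual 𝕜 (StrongDual 𝕜 F)} {V : Y →L[𝕜] Z}
    {W : lp (fun _ : K => 𝕜) 1 →L[𝕜] Y} (hU : IsApproximable U) (hV : 𝒜.Mem V)
    (hW : IsApproximable W)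
    (hfac : ∀ x : K, NormedSpace.inclusionInDoubleDual 𝕜 F x = U (V (W (lpOneBasis 𝕜 x))))
    {b : ℝ} (hb : ‖U‖ * (𝒜.idealNorm V * ‖W‖) < b) :
    ∃ (X : Type u) (_ : NormedAddCommGroup X) (_ : NormedSpace 𝕜 X) (_ : CompleteSpace X)
      (S : X →L[𝕜] F) (M : Set X), 𝒜.Mem S ∧ IsCompact M ∧ M ⊆ Metric.closedBall 0 1 ∧
        K ⊆ S '' M ∧ 𝒜.idealNorm S ≤ b := by
  have hV0 := idealNorm_nonneg hV
  have hU0 := norm_nonneg U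
  have hmax : ∀ x : K, ‖(x : F)‖ ≤ max C 0 := fun x => (hK x x.2).trans (le_max_left _ _)
  obtain ⟨u, hu, -⟩ := exists_lpOne_lift (𝕜 := 𝕜) (fun x : K => (x : F)) (le_max_right _ _) hmax
  have hJu : ∀ a, NormedSpace.inclusionInDoubleDual 𝕜 F (u a) = U ((V ∘L W) a) := by
    have h : NormedSpace.inclusionInDoubleDual 𝕜 F ∘L u = U ∘L (V ∘L W) :=
      lpOne_ext fun x => by simp [hu, hfac]
    exact fun a => congrArg (fun L => L a) h
  set B : ℝ := ‖U‖ * 𝒜.idealNorm V with hB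
  have hB0 : 0 ≤ B := by positivity
  -- `B * ‖W‖` pays for the term `n = 0`; `8 * η * 2` is the sum of the geometric bounds in `hWQ`.
  obtain ⟨η, hη, hηb⟩ : ∃ η : ℝ, 0 < η ∧ B * ‖W‖ + B * (8 * η) * 2 ≤ b := by
    have h : 0 < b - B * ‖W‖ := by rw [hB]; linarith
    refine ⟨(b - B * ‖W‖) / (16 * (B + 1)), by positivity, ?_⟩
    have h1 : (b - B * ‖W‖) / (16 * (B + 1)) * (16 * (B + 1)) = b - B * ‖W‖ :=
      div_mul_cancel₀ _ (by positivity)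
    have h2 : 0 < (b - B * ‖W‖) / (16 * (B + 1)) := by positivity
    nlinarith
  have htb : TotallyBounded (Set.range fun x : K => W (lpOneBasis 𝕜 x)) := by
    refine (totallyBounded_image_of_approximable hW 1).subset ?_
    rintro _ ⟨x, rfl⟩
    exact ⟨_, by simp [norm_lpOneBasis], rfl⟩
  choose π hπ hπW using fun n : ℕ =>
    exists_finite_discretization _ htb (show 0 < η * (1 / 4) ^ n by positivity)
  choose P hP hP1 using fun n : ℕ => exists_lpOne_lift (𝕜 := 𝕜)
    (fun x : K => lpOneBasis 𝕜 (π n x)) zero_le_one fun x => (norm_lpOneBasis _).le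
  -- Telescoping differences with `Q 0 = P 0`, so that `Q 0 + ⋯ + Q n = P n`.
  let Q : ℕ → lp (fun _ : K => 𝕜) 1 →L[𝕜] lp (fun _ : K => 𝕜) 1 := fun n =>
    P n - if n = 0 then 0 else P (n - 1)
  have hPfin : ∀ n, (Set.range fun x => P n (lpOneBasis 𝕜 x)).Finite := fun n => by
    simp only [hP]
    exact ((hπ n).image (lpOneBasis 𝕜)).subset
      (by rintro _ ⟨x, rfl⟩; exact ⟨_, ⟨x, rfl⟩, rfl⟩)
  have hQfin : ∀ n, (Set.range fun x => Q n (lpOneBasis 𝕜 x)).Finite := fun n => by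
    refine ((hPfin n).image2 (· - ·) ((hPfin (n - 1)).union (Set.finite_singleton 0))).subset ?_
    rintro _ ⟨x, rfl⟩
    refine ⟨_, ⟨x, rfl⟩, if n = 0 then 0 else P (n - 1) (lpOneBasis 𝕜 x), ?_, ?_⟩
    · split_ifs
      · exact Or.inr rfl
      · exact Or.inl ⟨x, rfl⟩
    · simp only [Q, sub_apply]
      split_ifs <;> rfl
  -- Replacing `x` by `σ n x` does not change `Q n e_x` but leaves finitely many vectors in
  -- coordinate `n`, which makes the range of `ξ` totally bounded.
  choose σ hσ hσQ using fun n => exists_finite_section _ (hQfin n)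
  have hQ : ∀ n, 𝒜.Mem (u ∘L Q n) ∧ 𝒜.idealNorm (u ∘L Q n) ≤ B * ‖W ∘L Q n‖ := fun n => by
    obtain ⟨s, p, hs⟩ := lpOne_eq_sum_rankOne (Q n) (hQfin n)
    obtain ⟨h1, h2⟩ :=
      idealNorm_comp_finiteRank_le (right_comp_mem hV W) hU hJu s p (Q n) hs
    refine ⟨h1, h2.trans ?_⟩
    rw [hB, mul_assoc]
    gcongr
    exact idealNorm_right_comp_le hV (W ∘L Q n)
  -- The `4⁻ⁿ` discretization error beats the weight `2ⁿ`, which `S` carries to cancel the `2⁻ⁿ` in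
  -- `ξ`.
  have hWQ : ∀ n, 2 ^ n * ‖W ∘L Q n‖ ≤ (if n = 0 then ‖W‖ else 0) + 8 * η * (1 / 2) ^ n := by
    rintro (_ | n)
    · have h : ‖W ∘L Q 0‖ ≤ ‖W‖ := by
        refine (W.opNorm_comp_le _).trans (mul_le_of_le_one_right (norm_nonneg _) ?_)
        simpa [Q] using hP1 0
      simp only [pow_zero, one_mul, if_true, mul_one]
      linarith
    · have h : ‖W ∘L Q (n + 1)‖ ≤ 2 * (η * (1 / 4) ^ n) := by
        refine lpOne_opNorm_le _ (by positivity) fun x => ?_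
        have h1 : (W ∘L Q (n + 1)) (lpOneBasis 𝕜 x) =
            (W (lpOneBasis 𝕜 (π (n + 1) x)) - W (lpOneBasis 𝕜 x)) -
              (W (lpOneBasis 𝕜 (π n x)) - W (lpOneBasis 𝕜 x)) := by
          simp [Q, hP]
        rw [h1]
        refine (norm_sub_le _ _).trans ?_
        have h2 := hπW (n + 1) x
        have h3 := hπW n x
        have h4 : η * (1 / 4) ^ (n + 1) ≤ η * (1 / 4 : ℝ) ^ n := by
          gcongr ?_ * ?_
          exact pow_le_pow_of_le_one (by norm_num) (by norm_num) n.le_succ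
        linarith
      calc 2 ^ (n + 1) * ‖W ∘L Q (n + 1)‖ ≤ 2 ^ (n + 1) * (2 * (η * (1 / 4) ^ n)) := by gcongr
        _ = 4 * η * (2 ^ n * (1 / 4) ^ n) := by ring
        _ = 4 * η * (1 / 2) ^ n := by rw [← mul_pow]; norm_num
        _ = _ := by rw [if_neg n.succ_ne_zero]; ring
  let ev : ∀ n : ℕ, (ℕ →ᵇ lp (fun _ : K => 𝕜) 1) →L[𝕜] lp (fun _ : K => 𝕜) 1 := fun n =>
    BoundedContinuousFunction.evalCLM 𝕜 n
  have hev : ∀ n, ‖ev n‖ ≤ 1 := fun n =>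
    ContinuousLinearMap.opNorm_le_bound _ zero_le_one fun f => by
      rw [one_mul]; exact f.norm_coe_le_norm n
  obtain ⟨S, hS, hSn, hlim⟩ := exists_sum_of_summable
    (T := fun n => ((2 : 𝕜) ^ n) • ((u ∘L Q n) ∘L ev n))
    (c := fun n => B * ((if n = 0 then ‖W‖ else 0) + 8 * η * (1 / 2) ^ n))
    (fun n => 𝒜.smul_mem _ _ (right_comp_mem (hQ n).1 _))
    (fun n => by
      rw [𝒜.norm_smul _ _ (right_comp_mem (hQ n).1 _), norm_pow, RCLike.norm_two]
      calc 2 ^ n * 𝒜.idealNorm ((u ∘L Q n) ∘L ev n)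
          ≤ 2 ^ n * (B * ‖W ∘L Q n‖) := by
            gcongr
            exact ((idealNorm_right_comp_le (hQ n).1 _).trans
              (mul_le_of_le_one_right (idealNorm_nonneg (hQ n).1) (hev n))).trans (hQ n).2
        _ = B * (2 ^ n * ‖W ∘L Q n‖) := by ring
        _ ≤ _ := by gcongr; exact hWQ n)
    (((hasSum_ite_eq 0 ‖W‖).summable.add (summable_geometric_two.mul_left (8 * η))).mul_left B)
  have hnorm : 𝒜.idealNorm S ≤ b := by
    refine hSn.trans (le_trans (le_of_eq ?_) hηb)
    rw [tsum_mul_left, (hasSum_ite_eq 0 ‖W‖).summable.tsum_add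
      (summable_geometric_two.mul_left (8 * η)), tsum_ite_eq, tsum_mul_left, tsum_geometric_two]
    ring
  have hzn : ∀ n (x : K), ‖((1 / 2 : 𝕜) ^ n) • lpOneBasis 𝕜 (σ n x)‖ ≤ (1 / 2) ^ n := fun n x => by
    rw [_root_.norm_smul, norm_lpOneBasis, mul_one, norm_pow, norm_div, norm_one, RCLike.norm_two]
  have hz1 : ∀ n (x : K), ‖((1 / 2 : 𝕜) ^ n) • lpOneBasis 𝕜 (σ n x)‖ ≤ 1 := fun n x =>
    (hzn n x).trans (pow_le_one₀ (by norm_num) (by norm_num))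
  let ξ : K → ℕ →ᵇ lp (fun _ : K => 𝕜) 1 := fun x =>
    BoundedContinuousFunction.ofNormedAddCommGroupDiscrete
      (fun n => ((1 / 2 : 𝕜) ^ n) • lpOneBasis 𝕜 (σ n x)) 1 fun n => hz1 n x
  have hξ : TotallyBounded (Set.range ξ) :=
    totallyBounded_range_boundedSeq (fun n x => ((1 / 2 : 𝕜) ^ n) • lpOneBasis 𝕜 (σ n x))
      (fun n => ((hσ n).image fun x => ((1 / 2 : 𝕜) ^ n) • lpOneBasis 𝕜 x).subset
        (by rintro _ ⟨x, rfl⟩; exact ⟨_, ⟨x, rfl⟩, rfl⟩)) hzn ξ fun _ _ => rfl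
  refine ⟨_, _, _, inferInstance, S, closure (Set.range ξ), hS,
    hξ.closure.isCompact_of_isClosed isClosed_closure, ?_, ?_, hnorm⟩
  · refine closure_minimal ?_ Metric.isClosed_closedBall
    rintro _ ⟨x, rfl⟩
    rw [mem_closedBall_zero_iff, BoundedContinuousFunction.norm_le zero_le_one]
    exact fun n => hz1 n x
  · intro x hx
    refine ⟨ξ ⟨x, hx⟩, subset_closure ⟨_, rfl⟩, ?_⟩
    have hterm : ∀ n, (((2 : 𝕜) ^ n) • ((u ∘L Q n) ∘L ev n)) (ξ ⟨x, hx⟩) =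
        u (Q n (lpOneBasis 𝕜 ⟨x, hx⟩)) := fun n => by
      change (2 : 𝕜) ^ n • u (Q n (((1 / 2 : 𝕜) ^ n) • lpOneBasis 𝕜 (σ n ⟨x, hx⟩))) = _
      rw [map_smul, map_smul, hσQ, smul_smul, ← mul_pow]
      simp
    have hpartial : ∀ n, ∑ i ∈ Finset.range (n + 1),
        (((2 : 𝕜) ^ i) • ((u ∘L Q i) ∘L ev i)) (ξ ⟨x, hx⟩) = (π n ⟨x, hx⟩ : F) := by
      intro n
      simp only [hterm]
      induction n with
      | zero => simp [Q, hP, hu]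
      | succ n ih =>
        rw [Finset.sum_range_succ, ih]
        simp [Q, hP, hu]
    have h1 := (Filter.tendsto_add_atTop_iff_nat 1).2 (hlim (ξ ⟨x, hx⟩))
    simp only [hpartial] at h1
    refine tendsto_nhds_unique h1 (tendsto_iff_norm_sub_tendsto_zero.2 ?_)
    have h4 : Filter.Tendsto (fun n : ℕ => ‖U ∘L V‖ * (η * (1 / 4 : ℝ) ^ n)) Filter.atTop
        (nhds 0) := by
      have := (tendsto_pow_atTop_nhds_zero_of_lt_one (r := (1 / 4 : ℝ)) (by norm_num)
        (by norm_num)).const_mul (‖U ∘L V‖ * η)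
      simpa [mul_assoc] using this
    refine squeeze_zero (fun _ => norm_nonneg _) (fun n => ?_) h4
    -- The convergence `π n x → x` in `F` is checked in `F''`, where the factorization reduces it to
    -- the discretization of `W`.
    rw [← (NormedSpace.inclusionInDoubleDualLi 𝕜 (E := F)).norm_map]
    have h5 : NormedSpace.inclusionInDoubleDualLi 𝕜 ((π n ⟨x, hx⟩ : F) - x) =
        (U ∘L V) (W (lpOneBasis 𝕜 (π n ⟨x, hx⟩)) - W (lpOneBasis 𝕜 ⟨x, hx⟩)) := by
      rw [map_sub, map_sub]
      exact congrArg₂ (· - ·) (hfac _) (hfac ⟨x, hx⟩)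
    rw [h5]
    exact (ContinuousLinearMap.le_opNorm _ _).trans (by gcongr; exact hπW n _)

theorem exists_compact_cover_of_bidual (h𝒜 : 𝒜.IsRightAccessible) {K : Set F}
    {X : Type u} [NormedAddCommGroup X] [NormedSpace 𝕜 X] [CompleteSpace X]
    {S : X →L[𝕜] StrongDual 𝕜 (StrongDual 𝕜 F)} {M : Set X} (hS : 𝒜.Mem S) (hM : IsCompact M)
    (hM1 : M ⊆ Metric.closedBall 0 1)
    (hK : NormedSpace.inclusionInDoubleDual 𝕜 F '' K ⊆ S '' M) {b : ℝ}
    (hb : 𝒜.idealNorm S < b) :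
    ∃ (X : Type u) (_ : NormedAddCommGroup X) (_ : NormedSpace 𝕜 X) (_ : CompleteSpace X)
      (S : X →L[𝕜] F) (M : Set X), 𝒜.Mem S ∧ IsCompact M ∧ M ⊆ Metric.closedBall 0 1 ∧
        K ⊆ S '' M ∧ 𝒜.idealNorm S ≤ b := by
  choose m hmM hm using fun x : K => hK ⟨x, x.2, rfl⟩
  have hm1 : ∀ x, ‖m x‖ ≤ 1 := fun x => mem_closedBall_zero_iff.1 (hM1 (hmM x))
  obtain ⟨q, hq, hq1⟩ := exists_lpOne_lift (𝕜 := 𝕜) m zero_le_one hm1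
  -- The values of `q` on unit vectors lie in the compact set `M`.
  have hqa : IsApproximable q := lpOne_approximable q
    (hM.totallyBounded.subset (by rintro _ ⟨x, rfl⟩; simpa [hq] using hmM x))
  obtain ⟨Z, _, _, _, Y, _, _, _, U, V, W, hU, hV, hW, hfac, hlt⟩ :=
    exists_minKernel_factorization h𝒜 hS hqa hq1 hb
  refine exists_compact_cover_of_factorization (C := ‖S‖) (fun x hx => ?_) hU hV hW
    (fun x => ?_) hlt
  · rw [← (NormedSpace.inclusionInDoubleDualLi 𝕜 (E := F)).norm_map]
    change ‖NormedSpace.inclusionInDoubleDual 𝕜 F x‖ ≤ _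
    rw [← hm ⟨x, hx⟩]
    exact S.unit_le_opNorm _ (hm1 _)
  · rw [← hm x, ← hq x]
    exact congrArg (fun L => L (lpOneBasis 𝕜 x)) hfac

/-! ### Relative `𝒜`-compactness and size in `F` and in `F''`. -/

/-- Rescaling `M` into the unit ball shows that the infimum defining `compactSize` runs over a
nonempty set. -/
theorem RelativelyCompact.exists_unit_ball {K : Set F} (hK : 𝒜.RelativelyCompact K) :
    ∃ (X : Type u) (_ : NormedAddCommGroup X) (_ : NormedSpace 𝕜 X) (_ : CompleteSpace X)
      (S : X →L[𝕜] F) (M : Set X), 𝒜.Mem S ∧ IsCompact M ∧ M ⊆ Metric.closedBall 0 1 ∧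
        K ⊆ S '' M := by
  obtain ⟨X, _, _, _, S, M, hS, hM, hKM⟩ := hK
  obtain ⟨r, hr, hMr⟩ := hM.isBounded.subset_closedBall_lt 0 0
  have hr' : (r : 𝕜) ≠ 0 := by exact_mod_cast hr.ne'
  refine ⟨X, _, _, ‹_›, (r : 𝕜) • S, (fun x => (r : 𝕜)⁻¹ • x) '' M, 𝒜.smul_mem _ _ hS,
    hM.image (continuous_const_smul _), ?_, ?_⟩
  · rintro _ ⟨x, hx, rfl⟩
    have := mem_closedBall_zero_iff.1 (hMr hx)
    rw [mem_closedBall_zero_iff, _root_.norm_smul, norm_inv, RCLike.norm_ofReal, abs_of_pos hr]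
    exact (inv_mul_le_one₀ hr).2 this
  · intro y hy
    obtain ⟨x, hx, rfl⟩ := hKM hy
    refine ⟨_, ⟨x, hx, rfl⟩, ?_⟩
    simp [smul_smul, hr']

theorem compactSize_le {K : Set F} {X : Type u} [NormedAddCommGroup X] [NormedSpace 𝕜 X]
    [CompleteSpace X] {S : X →L[𝕜] F} {M : Set X} (hS : 𝒜.Mem S) (hM : IsCompact M)
    (hM1 : M ⊆ Metric.closedBall 0 1) (hK : K ⊆ S '' M) :
    𝒜.compactSize K ≤ 𝒜.idealNorm S := by
  refine csInf_le ⟨0, ?_⟩ ⟨X, _, _, ‹_›, S, M, hS, hM, hM1, hK, rfl⟩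
  rintro r ⟨Y, _, _, _, A, N, hA, -, -, -, rfl⟩
  exact idealNorm_nonneg hA

theorem RelativelyCompact.le_compactSize {K : Set F} (hK : 𝒜.RelativelyCompact K) {c : ℝ}
    (h : ∀ (X : Type u) [NormedAddCommGroup X] [NormedSpace 𝕜 X] [CompleteSpace X]
      (S : X →L[𝕜] F) (M : Set X), 𝒜.Mem S → IsCompact M → M ⊆ Metric.closedBall 0 1 →
        K ⊆ S '' M → c ≤ 𝒜.idealNorm S) : c ≤ 𝒜.compactSize K := by
  obtain ⟨X, _, _, _, S, M, hS, hM, hM1, hKM⟩ := hK.exists_unit_ball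
  refine le_csInf ⟨_, X, _, _, ‹_›, S, M, hS, hM, hM1, hKM, rfl⟩ ?_
  rintro r ⟨Y, _, _, _, A, N, hA, hN, hN1, hKN, rfl⟩
  exact h Y A N hA hN hN1 hKN

theorem RelativelyCompact.image {K : Set F} (hK : 𝒜.RelativelyCompact K) {G : Type u}
    [NormedAddCommGroup G] [NormedSpace 𝕜 G] [CompleteSpace G] (L : F →L[𝕜] G) :
    𝒜.RelativelyCompact (L '' K) := by
  obtain ⟨X, _, _, _, S, M, hS, hM, hKM⟩ := hK
  refine ⟨X, _, _, ‹_›, L ∘L S, M, left_comp_mem hS L, hM, ?_⟩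
  rw [ContinuousLinearMap.coe_comp, Set.image_comp]
  exact Set.image_mono hKM

theorem relativelyCompact_bidual_iff (h𝒜 : 𝒜.IsRightAccessible) {K : Set F} :
    𝒜.RelativelyCompact K ↔
      𝒜.RelativelyCompact (NormedSpace.inclusionInDoubleDual 𝕜 F '' K) := by
  refine ⟨fun hK => hK.image _, fun hK => ?_⟩
  obtain ⟨X, _, _, _, S, M, hS, hM, hM1, hKM⟩ := hK.exists_unit_ball
  obtain ⟨Y, _, _, _, A, N, hA, hN, -, hKN, -⟩ :=
    exists_compact_cover_of_bidual h𝒜 hS hM hM1 hKM (lt_add_one _)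
  exact ⟨Y, _, _, ‹_›, A, N, hA, hN, hKN⟩

theorem compactSize_bidual (h𝒜 : 𝒜.IsRightAccessible) {K : Set F}
    (hK : 𝒜.RelativelyCompact K) :
    𝒜.compactSize K = 𝒜.compactSize (NormedSpace.inclusionInDoubleDual 𝕜 F '' K) := by
  refine le_antisymm ?_ ?_
  · refine (hK.image (NormedSpace.inclusionInDoubleDual 𝕜 F)).le_compactSize
      -- The descended cover costs at most any `b` above the norm of `S`, so nothing is lost in the
      -- infimum.
      fun X _ _ _ S M hS hM hM1 hKM => le_of_forall_gt_imp_ge_of_dense fun b hb => ?_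
    obtain ⟨Y, _, _, _, A, N, hA, hN, hN1, hKN, hAb⟩ :=
      exists_compact_cover_of_bidual h𝒜 hS hM hM1 hKM hb
    exact (compactSize_le hA hN hN1 hKN).trans hAb
  · refine hK.le_compactSize fun X _ _ _ S M hS hM hM1 hKM => ?_
    have hJS : NormedSpace.inclusionInDoubleDual 𝕜 F '' K ⊆
        (NormedSpace.inclusionInDoubleDual 𝕜 F ∘L S) '' M := by
      rw [ContinuousLinearMap.coe_comp, Set.image_comp]
      exact Set.image_mono hKM
    refine (compactSize_le (left_comp_mem hS _) hM hM1 hJS).trans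
      ((idealNorm_left_comp_le hS _).trans (mul_le_of_le_one_left (idealNorm_nonneg hS) ?_))
    exact NormedSpace.inclusionInDoubleDual_norm_le 𝕜 F

end BanachOperatorIdeal

theorem mainTheorem2 {𝕜 : Type} [RCLike 𝕜] (𝒜 : BanachOperatorIdeal.{u} 𝕜)
    (h𝒜 : 𝒜.IsRightAccessible) : 𝒜.compactOperators.IsRegular := by
  intro E F _ _ _ _ _ _ T
  have himage : (NormedSpace.inclusionInDoubleDual 𝕜 F ∘L T) '' Metric.closedBall (0 : E) 1 =
      NormedSpace.inclusionInDoubleDual 𝕜 F '' (T '' Metric.closedBall (0 : E) 1) := by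
    rw [ContinuousLinearMap.coe_comp, Set.image_comp]
  simp only [BanachOperatorIdeal.compactOperators, OperatorClass.regularHull]
  rw [himage]
  exact ⟨BanachOperatorIdeal.relativelyCompact_bidual_iff h𝒜,
    BanachOperatorIdeal.compactSize_bidual h𝒜⟩
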